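/- Conventions. For a monoid $S$ write $S^*$ for its group of units, $sS$ for the principal right ideal of $s$, and $s\perp t$ if $sS\cap tS=\emptyset$. $S$ is \emph{right LCM} if it is left cancellative and the intersection of any two principal right ideals is empty or a principal right ideal. The \emph{core} is $S_c=\{a\in S: a\not\perp s \text{ for all } s\in S\}$; the \emph{core relation} is $s\sim t$ iff $sa=tb$ for some $a,b\in S_c$; the set $S_{ci}$ of \emph{core irreducible} elements consists of all $s\in S\setminus S_c$ such that $s=ta$ with $t\in S$, $a\in S_c$ implies $a\in S^*$. $S$ is \emph{core factorable} if $S=(S_{ci}\cup\{1\})S_c$, and $S_{ci}\subset S$ is \emph{$\cap$-closed} if $s,t\in S_{ci}$ and $sS\cap tS=rS$ imply $r\in S_{ci}$. A group action is \emph{almost free} if every nontrivial group element has only finitely many fixed points. For a simple undirected graph $\Gamma=(V,E)$ and monoids $(S_v)_{v\in V}$, the \emph{graph product} $S_\Gamma$ is the quotient of the free product of the $S_v$ by the congruence generated by $(st,ts)$ for $s\in S_v$, $t\in S_w$, $(v,w)\in E$. $\Gamma$ is \emph{coconnected} if there is no partition $V=V_1\sqcup V_2$ into nonempty sets with $V_1\times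 V_2\subset E$. A vertex is \emph{isolated} if it emits no edge. Theorem. Let $\Gamma=(V,E)$ be a coconnected graph with $|V|\ge 2$ and let $(S_v)_{v\in V}$ be a family of nontrivial right LCM monoids. Then: (i) The canonical homomorphism from the graph product of $(S_v^*)_{v\in V}$ over $\Gamma$ to $S_\Gamma^*$ is an isomorphism, $(S_\Gamma)_c=S_\Gamma^*$, and $(S_\Gamma)_{ci}=S_\Gamma\setminus S_\Gamma^*$. (ii) For $s,t\in S_\Gamma$, $s\sim t$ if and only if $s\in tS_\Gamma^*$. (iii) $S_\Gamma$ is core factorable and $(S_\Gamma)_{ci}\subset S_\Gamma$ is $\cap$-closed. (iv) The action $\alpha\colon S_\Gamma^*\curvearrowright S_\Gamma/_\sim$, $x.[s]=[xs]$, is faithful if and only if $S_\Gamma$ is not a group. (v) The action $\alpha$ is almost free if and only if (a) for every isolated vertex $v\in V$, the action $\alpha_v^*\colon S_v^*\curvearrowright S_v/S_v^*$, $x.[s]=[xs]$, is almost free, and (b) for every connected component $U\subset V$ of $\Gamma$ with $|U|\ge 2$, either $S_u$ is a group for all $u\in U$ or $S_u^*$ is trivial for all $u\in U$. -/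

import Mathlib

/-! ### Right LCM monoids, the core and core irreducible elements -/

section RightLCM

/-- The principal right ideal `sS` of a monoid `S`. -/
def rightIdeal {S : Type*} [Monoid S] (s : S) : Set S := Set.range fun x : S => s * x

/-- A right LCM monoid: left cancellative, and any two principal right ideals have an
intersection that is empty or again a principal right ideal. -/
structure IsRightLCM (S : Type*) [Monoid S] : Prop where
  left_cancel : ∀ a b c : S, a * b = a * c → b = c
  inter_principal : ∀ s t : S, rightIdeal s ∩ rightIdeal t = ∅ ∨
    ∃ r : S, rightIdeal s ∩ rightIdeal t = rightIdeal r

/-- Orthogonality: `sS ∩ tS = ∅`. -/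
def Orthogonal {S : Type*} [Monoid S] (s t : S) : Prop := rightIdeal s ∩ rightIdeal t = ∅

theorem not_orthogonal_iff {S : Type*} [Monoid S] {s t : S} :
    ¬ Orthogonal s t ↔ ∃ x y : S, s * x = t * y := by
  unfold Orthogonal rightIdeal
  rw [← ne_eq, ← Set.nonempty_iff_ne_empty]
  constructor
  · rintro ⟨_, ⟨x, rfl⟩, ⟨y, hy⟩⟩
    exact ⟨x, y, hy.symm⟩
  · rintro ⟨x, y, h⟩
    exact ⟨s * x, ⟨x, rfl⟩, ⟨y, h.symm⟩⟩

/-- The core subsemigroup `S_c` of all elements that are orthogonal to no element. -/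
def core (S : Type*) [Monoid S] : Submonoid S where
  carrier := {a | ∀ s : S, ¬ Orthogonal a s}
  one_mem' := fun s => not_orthogonal_iff.2 ⟨s, 1, by simp⟩
  mul_mem' := by
    intro a b ha hb s
    obtain ⟨p, q, h⟩ := not_orthogonal_iff.1 (ha s)
    obtain ⟨p', q', h'⟩ := not_orthogonal_iff.1 (hb p)
    refine not_orthogonal_iff.2 ⟨p', q * q', ?_⟩
    rw [mul_assoc, h', ← mul_assoc, h, mul_assoc]

/-- The core relation: `s ∼ t` if `sa = tb` for some `a, b` in the core. -/
def CoreRel {S : Type*} [Monoid S] (s t : S) : Prop :=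
  ∃ a ∈ core S, ∃ b ∈ core S, s * a = t * b

/-- In a right LCM monoid the core relation is an equivalence relation. -/
theorem IsRightLCM.equivalence_coreRel {S : Type*} [Monoid S] (hS : IsRightLCM S) :
    Equivalence (CoreRel (S := S)) where
  refl s := ⟨1, one_mem _, 1, one_mem _, rfl⟩
  symm := fun ⟨a, ha, b, hb, h⟩ => ⟨b, hb, a, ha, h.symm⟩
  trans := by
    rintro s t r ⟨a, ha, b, hb, h⟩ ⟨c, hc, d, hd, h'⟩
    rcases hS.inter_principal b c with h0 | ⟨e, he⟩
    · exact absurd h0 (hb c)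
    have hee : e ∈ rightIdeal b ∩ rightIdeal c := he ▸ ⟨1, mul_one e⟩
    obtain ⟨⟨p, hp⟩, ⟨q, hq⟩⟩ := hee
    simp only at hp hq
    have hec : e ∈ core S := by
      intro s
      obtain ⟨x, y, hxy⟩ := not_orthogonal_iff.1 (hb s)
      obtain ⟨z, w, hzw⟩ := not_orthogonal_iff.1 (hc (b * x))
      have : c * z ∈ rightIdeal e := by
        rw [← he]
        exact ⟨⟨x * w, by simp only [hzw, mul_assoc]⟩, ⟨z, rfl⟩⟩
      obtain ⟨k, hk⟩ := this
      refine not_orthogonal_iff.2 ⟨k, y * w, ?_⟩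
      simp only at hk
      rw [hk, hzw, hxy, mul_assoc]
    have key : ∀ u v : S, u * v = e → v ∈ core S := by
      intro u v huv s
      obtain ⟨x, y, hxy⟩ := not_orthogonal_iff.1 (hec (u * s))
      refine not_orthogonal_iff.2 ⟨x, y, hS.left_cancel u _ _ ?_⟩
      rw [← mul_assoc, huv, hxy, mul_assoc]
    refine ⟨a * p, mul_mem ha (key b p hp), d * q, mul_mem hd (key c q hq), ?_⟩
    rw [← mul_assoc, h, mul_assoc, hp, ← hq, ← mul_assoc, h', mul_assoc]

/-- The set `S_ci` of core irreducible elements. -/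
def coreIrreducibles (S : Type*) [Monoid S] : Set S :=
  {s | s ∉ core S ∧ ∀ t : S, ∀ a ∈ core S, s = t * a → IsUnit a}

/-- `S` is core factorable: `S = (S_ci ∪ {1}) S_c`. -/
def IsCoreFactorable (S : Type*) [Monoid S] : Prop :=
  ∀ s : S, ∃ t ∈ coreIrreducibles S ∪ {1}, ∃ a ∈ core S, s = t * a

/-- A subset `C` of `S` is `∩`-closed: if `s, t ∈ C` and `sS ∩ tS = rS`, then `r ∈ C`. -/
def IsCapClosed {S : Type*} [Monoid S] (C : Set S) : Prop :=
  ∀ s ∈ C, ∀ t ∈ C, ∀ r : S, rightIdeal s ∩ rightIdeal t = rightIdeal r → r ∈ C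

end RightLCM

/-! ### The actions on `S/∼` and on `S/S*` -/

section Actions

/-- The quotient `S/∼` of `S` by the core relation (by `IsRightLCM.equivalence_coreRel` the
core relation of a right LCM monoid is an equivalence relation). -/
def CoreQuotient (S : Type*) [Monoid S] : Type _ := Quot (CoreRel (S := S))

/-- Left multiplication `a • [s] = [a * s]` on `S/∼`. The action `α` is its restriction
to the units (or to the core). -/
instance CoreQuotient.instMulAction (S : Type*) [Monoid S] : MulAction S (CoreQuotient S) where
  smul a := Quot.map (fun s => a * s) (by
    rintro s t ⟨c, hc, d, hd, h⟩
    exact ⟨c, hc, d, hd, by rw [mul_assoc, h, mul_assoc]⟩)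
  one_smul := by
    rintro ⟨s⟩
    exact congrArg (Quot.mk _) (one_mul s)
  mul_smul := by
    rintro a b ⟨s⟩
    exact congrArg (Quot.mk _) (mul_assoc a b s)

/-- The quotient `S/S*` of `S` by right multiplication with units (`Associated s t` means
`s * u = t` for some unit `u`). -/
def UnitQuotient (S : Type*) [Monoid S] : Type _ := Quotient (Associated.setoid S)

/-- Left multiplication `a • [s] = [a * s]` on `S/S*`. The action `α*` is its restriction
to the units. -/
instance UnitQuotient.instMulAction (S : Type*) [Monoid S] : MulAction S (UnitQuotient S) where
  smul a := Quotient.map (fun s => a * s) (by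
    rintro s t ⟨u, h⟩
    exact ⟨u, by rw [mul_assoc, h]⟩)
  one_smul := by
    rintro ⟨s⟩
    exact congrArg (Quot.mk _) (one_mul s)
  mul_smul := by
    rintro a b ⟨s⟩
    exact congrArg (Quot.mk _) (mul_assoc a b s)

/-- A group action is almost free if every nontrivial group element has only finitely many
fixed points. -/
def IsAlmostFree (H X : Type*) [Group H] [MulAction H X] : Prop :=
  ∀ g : H, g ≠ 1 → (MulAction.fixedBy X g).Finite

end Actions

/-! ### Graph products -/

section GraphProducts

/-- `G` is coconnected: there is no partition of the vertices into two nonempty sets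
such that every vertex of the first is adjacent to every vertex of the second. -/
def IsCoconnected {V : Type*} (G : SimpleGraph V) : Prop :=
  ¬ ∃ A B : Set V, A.Nonempty ∧ B.Nonempty ∧ Disjoint A B ∧ A ∪ B = Set.univ ∧
    ∀ v ∈ A, ∀ w ∈ B, G.Adj v w

/-- The congruence on the free product of the monoids `S v` that is generated by the pairs
`(st, ts)` with `s ∈ S v`, `t ∈ S w` and `v`, `w` adjacent. -/
def graphProductCon {V : Type*} (G : SimpleGraph V) (S : V → Type*) [∀ v, Monoid (S v)] :
    Con (Monoid.CoprodI S) :=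
  conGen fun x y => ∃ (v w : V) (_ : G.Adj v w) (s : S v) (t : S w),
    x = Monoid.CoprodI.of s * Monoid.CoprodI.of t ∧
    y = Monoid.CoprodI.of t * Monoid.CoprodI.of s

/-- The graph product of the monoids `S v`. -/
def GraphProduct {V : Type*} (G : SimpleGraph V) (S : V → Type*) [∀ v, Monoid (S v)] : Type _ :=
  (graphProductCon G S).Quotient

instance GraphProduct.instMonoid {V : Type*} (G : SimpleGraph V) (S : V → Type*)
    [∀ v, Monoid (S v)] : Monoid (GraphProduct G S) :=
  inferInstanceAs (Monoid (graphProductCon G S).Quotient)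

/-- The canonical homomorphism of a vertex monoid to the graph product. -/
def GraphProduct.of {V : Type*} (G : SimpleGraph V) (S : V → Type*) [∀ v, Monoid (S v)] (v : V) :
    S v →* GraphProduct G S :=
  (graphProductCon G S).mk'.comp Monoid.CoprodI.of

theorem GraphProduct.of_comm {V : Type*} (G : SimpleGraph V) (S : V → Type*)
    [∀ v, Monoid (S v)] {v w : V} (h : G.Adj v w) (s : S v) (t : S w) :
    of G S v s * of G S w t = of G S w t * of G S v s :=
  (Con.eq (graphProductCon G S)).2 (ConGen.Rel.of _ _ ⟨v, w, h, s, t, rfl, rfl⟩)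

/-- The universal property: homomorphisms on the vertex monoids whose images commute for
adjacent vertices extend to the graph product. -/
def GraphProduct.lift {V : Type*} (G : SimpleGraph V) (S : V → Type*) [∀ v, Monoid (S v)]
    {N : Type*} [Monoid N] (f : ∀ v, S v →* N)
    (hf : ∀ v w, G.Adj v w → ∀ (s : S v) (t : S w), f v s * f w t = f w t * f v s) :
    GraphProduct G S →* N :=
  (graphProductCon G S).lift (Monoid.CoprodI.lift f) (by
    refine Con.conGen_le.2 ?_
    rintro x y ⟨v, w, h, s, t, rfl, rfl⟩
    simpa [Con.ker_rel] using hf v w h s t)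

/-- The canonical homomorphism from the graph product of the unit groups of the vertex monoids
to the unit group of the graph product, which sends `u ∈ (S v)ˣ` to its image under
`GraphProduct.of`. -/
def GraphProduct.unitsHom {V : Type*} (G : SimpleGraph V) (S : V → Type*)
    [∀ v, Monoid (S v)] :
    GraphProduct G (fun v => (S v)ˣ) →* (GraphProduct G S)ˣ :=
  GraphProduct.lift G (fun v => (S v)ˣ) (fun v => Units.map (GraphProduct.of G S v)) (by
    intro v w h s t
    ext
    exact GraphProduct.of_comm G S h s t)

end GraphProducts

/-! ### Left cancellative monoids -/

section LeftCancel

variable {M : Type*} [Monoid M]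

/-! No normal form for graph products is used; apart from free product words over an isolated
vertex, everything is read off from homomorphisms given by the universal property. By left
cancellation the nonunits of each `S v` form an ideal (possibly empty), so a homomorphism on `(S
v)ˣ` extends to `S v` by sending all nonunits to an idempotent that absorbs its values. Choosing the
target well detects what is needed.

With an adjoined zero as the idempotent, this determines the units (`unitsHom_bijective`). Acting on
a vertex monoid `S w` with a constant map as idempotent shows that a nonunit over `v` is orthogonal
to some element when `w` is not adjacent to `v`; coconnectedness supplies such a `w`, so the core is
the unit group (`core_eq`). The statements on the core relation, factorability and `∩`-closedness
follow formally.

Acting on sets of units locates a unit `x` that fixes `[s]`: over the star of `w` if `s` is a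
nonunit over `w`, and over the component of `w` if `s` merely starts with one. For faithfulness, the
vertices needed to write the units acting trivially are shown to be adjacent to all others, so
coconnectedness leaves none (`eq_one_of_forall_mul_eq`). For almost freeness, fixing the class of a
nonunit forces a conjugate of `x` into a vertex group over an isolated vertex, where `S_Γ` splits as
a free product and words finish the count. Conversely, a nontrivial unit adjacent to a nonunit `a`
fixes all `[a ^ n]`. -/

theorem IsRightLCM.mul_eq_one_symm (hM : IsRightLCM M) {a b : M} (h : a * b = 1) : b * a = 1 :=
  hM.left_cancel a _ _ (by rw [← mul_assoc, h, one_mul, mul_one])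

theorem IsRightLCM.isUnit_mul (hM : IsRightLCM M) {a b : M} (h : IsUnit (a * b)) :
    IsUnit a ∧ IsUnit b := by
  obtain ⟨u, hu⟩ := h
  have h1 : a * (b * ↑u⁻¹) = 1 := by rw [← mul_assoc, ← hu, Units.mul_inv]
  have ha : IsUnit a := ⟨⟨a, _, h1, hM.mul_eq_one_symm h1⟩, rfl⟩
  refine ⟨ha, ?_⟩
  obtain ⟨v, rfl⟩ := ha
  have : b = ↑(v⁻¹ * u) := by rw [Units.val_mul, hu, Units.inv_mul_cancel_left]
  exact this ▸ Units.isUnit _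

/-- In a left cancellative monoid the powers of a nonunit are pairwise non-associated. -/
theorem IsRightLCM.pow_not_associated (hM : IsRightLCM M) {a : M} (ha : ¬ IsUnit a) {m n : ℕ}
    (h : Associated (a ^ m) (a ^ n)) : m = n := by
  wlog hmn : m ≤ n generalizing m n
  · exact (this h.symm (by omega)).symm
  obtain ⟨k, rfl⟩ := Nat.exists_eq_add_of_le hmn
  obtain ⟨u, hu⟩ := h
  rw [pow_add] at hu
  have hk := hM.left_cancel _ _ _ hu
  rcases k with _ | k
  · rfl
  · rw [pow_succ] at hk
    exact absurd (hM.isUnit_mul (hk ▸ u.isUnit)).2 ha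

/-- A homomorphism on the units together with an idempotent that absorbs its values extends to
the monoid if the nonunits form an ideal. -/
noncomputable def extendByIdempotent (hM : IsRightLCM M) {N : Type*} [Monoid N] (f : Mˣ →* N)
    (e : N) (he : e * e = e) (hl : ∀ u, f u * e = e) (hr : ∀ u, e * f u = e) : M →* N where
  toFun s := open Classical in if h : IsUnit s then f h.unit else e
  map_one' := by
    rw [dif_pos isUnit_one, ← map_one f]
    congr 1
    ext
    rfl
  map_mul' a b := by
    by_cases ha : IsUnit a <;> by_cases hb : IsUnit b
    · rw [dif_pos ha, dif_pos hb, dif_pos (ha.mul hb), ← map_mul]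
      congr 1
      ext
      rfl
    · rw [dif_pos ha, dif_neg hb, dif_neg fun h => hb (hM.isUnit_mul h).2, hl]
    · rw [dif_neg ha, dif_pos hb, dif_neg fun h => ha (hM.isUnit_mul h).1, hr]
    · rw [dif_neg ha, dif_neg hb, dif_neg fun h => ha (hM.isUnit_mul h).1, he]

theorem extendByIdempotent_unit (hM : IsRightLCM M) {N : Type*} [Monoid N] (f : Mˣ →* N)
    (e : N) (he : e * e = e) (hl : ∀ u, f u * e = e) (hr : ∀ u, e * f u = e) (u : Mˣ) :
    extendByIdempotent hM f e he hl hr u = f u := by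
  simp only [extendByIdempotent, MonoidHom.coe_mk, OneHom.coe_mk, dif_pos u.isUnit]
  congr 1
  ext
  rfl

theorem extendByIdempotent_nonunit (hM : IsRightLCM M) {N : Type*} [Monoid N] (f : Mˣ →* N)
    (e : N) (he : e * e = e) (hl : ∀ u, f u * e = e) (hr : ∀ u, e * f u = e) {a : M}
    (ha : ¬ IsUnit a) : extendByIdempotent hM f e he hl hr a = e := by
  simp only [extendByIdempotent, MonoidHom.coe_mk, OneHom.coe_mk, dif_neg ha]

end LeftCancel

/-! ### Homomorphisms out of a graph product -/

namespace GraphProduct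

section General

variable {V : Type*} (G : SimpleGraph V) (S : V → Type*) [∀ v, Monoid (S v)]

@[simp]
theorem lift_of {N : Type*} [Monoid N] (f : ∀ v, S v →* N)
    (hf : ∀ v w, G.Adj v w → ∀ (s : S v) (t : S w), f v s * f w t = f w t * f v s)
    (v : V) (s : S v) : lift G S f hf (of G S v s) = f v s :=
  Monoid.CoprodI.lift_of f s

variable {G S} in
@[elab_as_elim]
theorem induction_left {motive : GraphProduct G S → Prop} (s : GraphProduct G S)
    (one : motive 1) (mul : ∀ v (m : S v) x, motive x → motive (of G S v m * x)) : motive s := by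
  obtain ⟨s, rfl⟩ := Con.mk'_surjective s
  induction s using Monoid.CoprodI.induction_left with
  | one => exact one
  | mul m x hx => exact mul _ m _ hx

variable {G S} in
theorem hom_ext {N : Type*} [Monoid N] {f g : GraphProduct G S →* N}
    (h : ∀ v s, f (of G S v s) = g (of G S v s)) : f = g := by
  ext s
  induction s using induction_left with
  | one => rw [map_one, map_one]
  | mul v m x hx => rw [map_mul, map_mul, h, hx]

/-- The canonical homomorphism of the graph product to the direct product. -/
noncomputable def toPi : GraphProduct G S →* ∀ v, S v :=
  open Classical in lift G S (fun v => MonoidHom.mulSingle S v)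
    (fun _ _ h s t => Pi.mulSingle_commute h.ne s t)

@[simp]
theorem toPi_of_same (v : V) (s : S v) : toPi G S (of G S v s) v = s := by
  exact (congrFun (lift_of (N := ∀ v, S v) G S _ _ v s) v).trans (by simp)

theorem toPi_of_ne {v w : V} (h : w ≠ v) (s : S v) : toPi G S (of G S v s) w = 1 := by
  exact (congrFun (lift_of (N := ∀ v, S v) G S _ _ v s) w).trans (by simp [h])

/-- The endomorphism of the graph product that deletes the letters outside of `U`. -/
noncomputable def restrict (U : Set V) : GraphProduct G S →* GraphProduct G S :=
  open Classical in lift G S (fun v => if v ∈ U then of G S v else 1) (by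
    intro v w h s t
    split_ifs <;> simp [of_comm G S h])

theorem restrict_of_mem {U : Set V} {v : V} (h : v ∈ U) (s : S v) :
    restrict G S U (of G S v s) = of G S v s := by
  simp [restrict, h]

theorem restrict_of_notMem {U : Set V} {v : V} (h : v ∉ U) (s : S v) :
    restrict G S U (of G S v s) = 1 := by
  simp [restrict, h]

theorem restrict_restrict (U W : Set V) (s : GraphProduct G S) :
    restrict G S U (restrict G S W s) = restrict G S (U ∩ W) s := by
  suffices (restrict G S U).comp (restrict G S W) = restrict G S (U ∩ W) from
    DFunLike.congr_fun this s
  refine hom_ext fun v s => ?_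
  rw [MonoidHom.comp_apply]
  by_cases hW : v ∈ W <;> by_cases hU : v ∈ U
  · rw [restrict_of_mem G S hW, restrict_of_mem G S hU, restrict_of_mem G S (U := U ∩ W) ⟨hU, hW⟩]
  · rw [restrict_of_mem G S hW, restrict_of_notMem G S hU,
      restrict_of_notMem G S (U := U ∩ W) fun h => hU h.1]
  · rw [restrict_of_notMem G S hW, map_one, restrict_of_notMem G S (U := U ∩ W) fun h => hW h.2]
  · rw [restrict_of_notMem G S hW, map_one, restrict_of_notMem G S (U := U ∩ W) fun h => hW h.2]

/-- Every element involves finitely many vertices. -/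
theorem exists_finset_restrict_compl_eq_one (s : GraphProduct G S) :
    ∃ F : Finset V, restrict G S (F : Set V)ᶜ s = 1 := by
  classical
  induction s using induction_left with
  | one => exact ⟨∅, map_one _⟩
  | mul v m x hx =>
    obtain ⟨F, hF⟩ := hx
    refine ⟨insert v F, ?_⟩
    rw [map_mul, restrict_of_notMem G S (by simp), one_mul]
    have : ((insert v F : Finset V) : Set V)ᶜ = {v}ᶜ ∩ (F : Set V)ᶜ := by
      ext
      simp
    rw [this, ← restrict_restrict, hF, map_one]

/-- The subgroup of the units of the graph product that is generated by the units of the vertex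
monoids over `U`. -/
def unitsOver (U : Set V) : Subgroup (GraphProduct G S)ˣ :=
  Subgroup.closure {z | ∃ v ∈ U, ∃ u : (S v)ˣ, z = Units.map (of G S v) u}

variable {G S} in
theorem map_of_mem_unitsOver {U : Set V} {v : V} (h : v ∈ U) (u : (S v)ˣ) :
    Units.map (of G S v) u ∈ unitsOver G S U :=
  Subgroup.subset_closure ⟨v, h, u, rfl⟩

variable {G S} in
theorem unitsOver_mono {U W : Set V} (h : U ⊆ W) : unitsOver G S U ≤ unitsOver G S W :=
  Subgroup.closure_mono fun _ ⟨v, hv, u, hu⟩ => ⟨v, h hv, u, hu⟩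

variable {G S} in
theorem restrict_eq_self_of_mem_unitsOver {U : Set V} {x : (GraphProduct G S)ˣ}
    (hx : x ∈ unitsOver G S U) : restrict G S U x = x := by
  suffices unitsOver G S U ≤ MonoidHom.eqLocus (Units.map (restrict G S U)) (MonoidHom.id _) from
    congrArg Units.val (this hx)
  refine (Subgroup.closure_le _).2 ?_
  rintro _ ⟨v, hv, u, rfl⟩
  exact Units.ext (restrict_of_mem G S hv _)

variable {G S} in
/-- A unit that can be written without each single vertex is trivial. -/
theorem eq_one_of_forall_mem_unitsOver_compl {x : (GraphProduct G S)ˣ}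
    (hx : ∀ u, x ∈ unitsOver G S {u}ᶜ) : x = 1 := by
  classical
  -- The vertices of `F` are deleted one at a time without changing `x`. Taking for `F` the finitely
  -- many vertices involved in `x` then gives 1.
  have key : ∀ F : Finset V, restrict G S (F : Set V)ᶜ x = x := by
    intro F
    induction F using Finset.induction_on with
    | empty =>
      refine restrict_eq_self_of_mem_unitsOver ?_
      obtain h | ⟨⟨u⟩⟩ := isEmpty_or_nonempty V
      · have : ∀ s : GraphProduct G S, s = 1 := fun s => by
          induction s using induction_left with
          | one => rfl
          | mul v => exact (h.false v).elim
        exact (Units.ext (this x) : x = 1) ▸ one_mem _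
      · exact unitsOver_mono (by simp) (hx u)
    | insert u F _ ih =>
      have : ((insert u F : Finset V) : Set V)ᶜ = (F : Set V)ᶜ ∩ {u}ᶜ := by
        ext
        simp [and_comm]
      rw [this, ← restrict_restrict, restrict_eq_self_of_mem_unitsOver (hx u), ih]
  obtain ⟨F, hF⟩ := exists_finset_restrict_compl_eq_one G S (x : GraphProduct G S)
  exact Units.ext ((key F).symm.trans hF)

end General

/-! ### The units of a graph product -/

section Units

variable {V : Type*} {G : SimpleGraph V} {S : V → Type*} [∀ v, Monoid (S v)]

/-- Extend a homomorphism on the units of the vertex monoids to the graph product by sending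
all nonunits over a vertex to the same idempotent. -/
noncomputable def extend (hS : ∀ v, IsRightLCM (S v)) {N : Type*} [Monoid N] (f : ∀ v, (S v)ˣ →* N) (e : V → N)
    (he : ∀ v, e v * e v = e v) (hl : ∀ v u, f v u * e v = e v) (hr : ∀ v u, e v * f v u = e v)
    (hff : ∀ v w, G.Adj v w → ∀ a b, f v a * f w b = f w b * f v a)
    (hfe : ∀ v w, G.Adj v w → ∀ a, f v a * e w = e w * f v a)
    (hee : ∀ v w, G.Adj v w → e v * e w = e w * e v) : GraphProduct G S →* N :=
  lift G S (fun v => extendByIdempotent (hS v) (f v) (e v) (he v) (hl v) (hr v)) (by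
    intro v w h s t
    by_cases hs : IsUnit s <;> by_cases ht : IsUnit t
    · obtain ⟨s, rfl⟩ := hs
      obtain ⟨t, rfl⟩ := ht
      simp only [extendByIdempotent_unit, hff v w h]
    · obtain ⟨s, rfl⟩ := hs
      simp only [extendByIdempotent_unit, extendByIdempotent_nonunit _ _ _ _ _ _ ht, hfe v w h]
    · obtain ⟨t, rfl⟩ := ht
      simp only [extendByIdempotent_unit, extendByIdempotent_nonunit _ _ _ _ _ _ hs,
        hfe w v h.symm]
    · simp only [extendByIdempotent_nonunit _ _ _ _ _ _ ht,
        extendByIdempotent_nonunit _ _ _ _ _ _ hs, hee v w h])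

section

variable (hS : ∀ v, IsRightLCM (S v)) {N : Type*} [Monoid N] (f : ∀ v, (S v)ˣ →* N) (e : V → N)
    (he : ∀ v, e v * e v = e v) (hl : ∀ v u, f v u * e v = e v) (hr : ∀ v u, e v * f v u = e v)
    (hff : ∀ v w, G.Adj v w → ∀ a b, f v a * f w b = f w b * f v a)
    (hfe : ∀ v w, G.Adj v w → ∀ a, f v a * e w = e w * f v a)
    (hee : ∀ v w, G.Adj v w → e v * e w = e w * e v)

theorem extend_of_unit (v : V) (u : (S v)ˣ) :
    extend hS f e he hl hr hff hfe hee (of G S v u) = f v u := by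
  rw [extend, lift_of, extendByIdempotent_unit]

theorem extend_of_nonunit {v : V} {a : S v} (ha : ¬ IsUnit a) :
    extend hS f e he hl hr hff hfe hee (of G S v a) = e v := by
  rw [extend, lift_of, extendByIdempotent_nonunit _ _ _ _ _ _ ha]

end

/-- The homomorphism to the graph product of the unit groups with an adjoined zero that sends
all nonunits of the vertex monoids to zero. -/
noncomputable def toWithZero (hS : ∀ v, IsRightLCM (S v)) :
    GraphProduct G S →* WithZero (GraphProduct G fun v => (S v)ˣ) :=
  extend hS (fun v => WithZero.coeMonoidHom.comp (of G (fun v => (S v)ˣ) v)) (fun _ => 0)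
    (by simp) (by simp) (by simp)
    (fun v w h a b => by
      simpa using congrArg WithZero.coeMonoidHom (of_comm G (fun v => (S v)ˣ) h a b))
    (by simp) (by simp)

theorem unitsHom_of (v : V) (u : (S v)ˣ) :
    unitsHom G S (of G (fun v => (S v)ˣ) v u) = Units.map (of G S v) u :=
  lift_of ..

theorem toWithZero_unitsHom (hS : ∀ v, IsRightLCM (S v))
    (x : GraphProduct G fun v => (S v)ˣ) :
    toWithZero hS (unitsHom G S x) = WithZero.coeMonoidHom x := by
  suffices (toWithZero hS).comp ((Units.coeHom _).comp (unitsHom G S)) = WithZero.coeMonoidHom from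
    DFunLike.congr_fun this x
  refine hom_ext fun v s => ?_
  simp only [MonoidHom.comp_apply, unitsHom_of]
  exact extend_of_unit ..

theorem unitsHom_injective (hS : ∀ v, IsRightLCM (S v)) : Function.Injective (unitsHom G S) := by
  intro x y h
  have := congrArg (fun z : (GraphProduct G S)ˣ => toWithZero hS (z : GraphProduct G S)) h
  simp only [toWithZero_unitsHom] at this
  exact WithZero.coe_injective this

/-- An element of a graph product is a product of units of the vertex monoids, or there is a
first letter that is not a unit. -/
theorem exists_unit_or_exists_nonunit (s : GraphProduct G S) :
    (∃ x, s = unitsHom G S x) ∨ ∃ (x : _) (w : V) (a : S w) (t : GraphProduct G S),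
      ¬ IsUnit a ∧ s = unitsHom G S x * (of G S w a * t) := by
  induction s using induction_left with
  | one => exact Or.inl ⟨1, by simp⟩
  | mul v m s ih =>
    by_cases hm : IsUnit m
    · obtain ⟨m, rfl⟩ := hm
      have hm' : of G S v m = (unitsHom G S (of G (fun v => (S v)ˣ) v m) : GraphProduct G S) := by
        rw [unitsHom_of, Units.coe_map]
      rcases ih with ⟨x, rfl⟩ | ⟨x, w, a, t, ha, rfl⟩
      · exact Or.inl ⟨of G _ v m * x, by rw [hm', map_mul, Units.val_mul]⟩
      · exact Or.inr ⟨of G _ v m * x, w, a, t, ha, by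
          rw [hm', map_mul, Units.val_mul, mul_assoc]⟩
    · exact Or.inr ⟨1, v, m, s, hm, by simp⟩

/-- A single nonunit letter makes the image under `toWithZero` equal to 0, which is not a unit. -/
theorem not_isUnit_mul_nonunit (hS : ∀ v, IsRightLCM (S v))
    (p t : GraphProduct G S) {w : V} {a : S w} (ha : ¬ IsUnit a) :
    ¬ IsUnit (p * (of G S w a * t)) := by
  intro h
  have := h.map (toWithZero hS)
  have h0 : toWithZero hS (of G S w a) = 0 := extend_of_nonunit _ _ _ _ _ _ _ _ _ ha
  rw [map_mul, map_mul, h0, zero_mul, mul_zero] at this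
  exact not_isUnit_zero this

theorem unitsHom_bijective (hS : ∀ v, IsRightLCM (S v)) : Function.Bijective (unitsHom G S) := by
  refine ⟨unitsHom_injective hS, fun z => ?_⟩
  rcases exists_unit_or_exists_nonunit (z : GraphProduct G S) with
    ⟨x, hx⟩ | ⟨x, w, a, t, ha, hz⟩
  · exact ⟨x, Units.ext hx.symm⟩
  · exact absurd (hz ▸ z.isUnit) (not_isUnit_mul_nonunit hS _ t ha)

/-- An element of a graph product that is not a unit has a first letter that is not a unit. -/
theorem exists_eq_of_not_isUnit {s : GraphProduct G S} (hs : ¬ IsUnit s) :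
    ∃ (b : (GraphProduct G S)ˣ) (w : V) (a : S w) (t : GraphProduct G S),
      ¬ IsUnit a ∧ s = b * (of G S w a * t) := by
  rcases exists_unit_or_exists_nonunit s with ⟨x, rfl⟩ | ⟨x, w, a, t, ha, hz⟩
  · exact absurd (Units.isUnit _) hs
  · exact ⟨_, w, a, t, ha, hz⟩

theorem isUnit_mul (hS : ∀ v, IsRightLCM (S v))
    {s t : GraphProduct G S} (h : IsUnit (s * t)) : IsUnit s ∧ IsUnit t := by
  by_cases hs : IsUnit s
  · refine ⟨hs, ?_⟩
    obtain ⟨u, rfl⟩ := hs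
    simpa using h
  · obtain ⟨b, w, a, r, ha, rfl⟩ := exists_eq_of_not_isUnit hs
    refine absurd h ?_
    rw [mul_assoc, mul_assoc]
    exact not_isUnit_mul_nonunit hS _ _ ha

theorem mul_eq_one_symm (hS : ∀ v, IsRightLCM (S v))
    {s t : GraphProduct G S} (h : s * t = 1) : t * s = 1 := by
  obtain ⟨u, rfl⟩ := (isUnit_mul hS (h ▸ isUnit_one)).1
  rw [← Units.mul_right_inj u, ← mul_assoc, h, one_mul, mul_one]

theorem isUnit_of_iff {v : V} {a : S v} : IsUnit (of G S v a) ↔ IsUnit a := by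
  refine ⟨fun h => ?_, fun h => h.map _⟩
  simpa using h.map ((Pi.evalMonoidHom S v).comp (toPi G S))

end Units

end GraphProduct

namespace GraphProduct

/-! ### The core of a graph product -/

section Core

variable {V : Type*} {G : SimpleGraph V} {S : V → Type*} [∀ v, Monoid (S v)]

/-- A homomorphism to the transformations of `S w` under which every nonunit over `v` is
constant. -/
theorem exists_hom_end (hS : ∀ v, IsRightLCM (S v)) {v w : V} (hvw : w ≠ v)
    (h : ¬ G.Adj v w) :
    ∃ φ : GraphProduct G S →* Function.End (S w),
      (∀ a : S v, ¬ IsUnit a → φ (of G S v a) = fun _ => 1) ∧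
      ∀ c : S w, φ (of G S w c) = fun z => c * z := by
  classical
  -- `S w` acts by left multiplication, units over `v` and all other vertex monoids trivially. The
  -- only noncommuting pair of vertices is `v`, `w`, which is not an edge.
  let f : ∀ x, S x →* Function.End (S w) := fun x =>
    if x = v then extendByIdempotent (hS x) 1 (fun _ => 1) rfl (fun _ => rfl) (fun _ => rfl)
    else MulAction.toEndHom.comp ((Pi.evalMonoidHom S w).comp (MonoidHom.mulSingle S x))
  have hf : ∀ x, x ≠ v → x ≠ w → ∀ s, f x s = 1 := by
    intro x hv hw s
    simp [f, hv, hw.symm]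
  refine ⟨lift G S f ?_, fun a ha => ?_, fun c => ?_⟩
  · intro x y hxy s t
    by_cases hx : x ≠ v ∧ x ≠ w
    · rw [hf x hx.1 hx.2, one_mul, mul_one]
    by_cases hy : y ≠ v ∧ y ≠ w
    · rw [hf y hy.1 hy.2, one_mul, mul_one]
    exfalso
    have := hxy.symm
    by_cases x = v <;> by_cases y = v <;> simp_all
  · simp only [lift_of, f, if_true]
    exact extendByIdempotent_nonunit _ _ _ _ _ _ ha
  · funext z
    simp only [lift_of, f, if_neg hvw]
    simp
    rfl

/-- Under `exists_hom_end` every right multiple of `a` maps to the constant 1, and every right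
multiple of `c * a` to the constant `c`. -/
theorem orthogonal_of_not_adj (hS : ∀ v, IsRightLCM (S v)) {v w : V} (hvw : w ≠ v)
    (h : ¬ G.Adj v w) {a : S v} (ha : ¬ IsUnit a) {c : S w} (hc : c ≠ 1) :
    Orthogonal (of G S v a) (of G S w c * of G S v a) := by
  by_contra hn
  obtain ⟨x, y, hxy⟩ := not_orthogonal_iff.1 hn
  obtain ⟨φ, hφ, hφ'⟩ := exists_hom_end hS hvw h
  have := congrFun (congrArg φ hxy) 1
  rw [map_mul, map_mul, map_mul, hφ a ha, hφ' c] at this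
  refine hc ?_
  rw [← mul_one c]
  exact this.symm

theorem _root_.IsCoconnected.exists_not_adj [Nontrivial V] (hG : IsCoconnected G) (v : V) :
    ∃ w, w ≠ v ∧ ¬ G.Adj v w := by
  by_contra! h
  obtain ⟨w, hw⟩ := exists_ne v
  exact hG ⟨{v}, {v}ᶜ, ⟨v, rfl⟩, ⟨w, hw⟩, disjoint_compl_right, Set.union_compl_self _,
    fun x hx y hy => by
      obtain rfl : x = v := hx
      exact h y hy⟩

theorem core_eq [Nontrivial V] (hG : IsCoconnected G) [∀ v, Nontrivial (S v)]
    (hS : ∀ v, IsRightLCM (S v)) :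
    core (GraphProduct G S) = IsUnit.submonoid (GraphProduct G S) := by
  refine SetLike.ext fun s => ⟨fun hs => ?_, ?_⟩
  · by_contra hu
    obtain ⟨b, v, a, t, ha, rfl⟩ := exists_eq_of_not_isUnit hu
    obtain ⟨w, hw, hvw⟩ := hG.exists_not_adj v
    obtain ⟨c, hc⟩ := exists_ne (1 : S w)
    obtain ⟨x, y, hxy⟩ := not_orthogonal_iff.1 (hs (b * (of G S w c * of G S v a)))
    refine not_orthogonal_iff.2 ⟨t * x, y, ?_⟩ (orthogonal_of_not_adj hS hw hvw ha hc)
    rw [mul_assoc, mul_assoc, mul_assoc, Units.mul_right_inj] at hxy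
    exact hxy
  · rintro ⟨u, rfl⟩ s
    exact not_orthogonal_iff.2 ⟨↑u⁻¹ * s, 1, by simp⟩

end Core

/-! ### Actions of a graph product that extend actions of its units -/

section Actions

open scoped Pointwise

variable {V : Type*} {G : SimpleGraph V} {S : V → Type*} [∀ v, Monoid (S v)]

/-- Two homomorphisms on the units agree if they agree on the units of the vertex monoids. -/
theorem units_hom_ext (hS : ∀ v, IsRightLCM (S v)) {N : Type*} [Monoid N]
    {f g : (GraphProduct G S)ˣ →* N}
    (h : ∀ v (u : (S v)ˣ), f (Units.map (of G S v) u) = g (Units.map (of G S v) u)) : f = g := by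
  have : f.comp (unitsHom G S) = g.comp (unitsHom G S) := hom_ext fun v u => by
    simpa only [MonoidHom.comp_apply, unitsHom_of] using h v u
  exact (MonoidHom.cancel_right (unitsHom_bijective hS).2).1 this

/-- Extend a homomorphism on the units of the graph product to the graph product by sending
all nonunits over a vertex to the same idempotent. -/
theorem exists_extension (hS : ∀ v, IsRightLCM (S v)) {N : Type*} [Monoid N]
    (φ : (GraphProduct G S)ˣ →* N) (e : V → N) (he : ∀ v, e v * e v = e v)
    (hl : ∀ v u, φ (Units.map (of G S v) u) * e v = e v)
    (hr : ∀ v u, e v * φ (Units.map (of G S v) u) = e v)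
    (hfe : ∀ v w, G.Adj v w → ∀ a,
      φ (Units.map (of G S v) a) * e w = e w * φ (Units.map (of G S v) a))
    (hee : ∀ v w, G.Adj v w → e v * e w = e w * e v) :
    ∃ ψ : GraphProduct G S →* N, (∀ x : (GraphProduct G S)ˣ, ψ x = φ x) ∧
      ∀ v (a : S v), ¬ IsUnit a → ψ (of G S v a) = e v := by
  have hff : ∀ v w, G.Adj v w → ∀ (a : (S v)ˣ) (b : (S w)ˣ),
      φ.comp (Units.map (of G S v)) a * φ.comp (Units.map (of G S w)) b =
        φ.comp (Units.map (of G S w)) b * φ.comp (Units.map (of G S v)) a := by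
    intro v w h a b
    simp only [MonoidHom.comp_apply, ← map_mul]
    exact congrArg φ (Units.ext (of_comm G S h _ _))
  let ψ := extend hS (fun v => φ.comp (Units.map (of G S v))) e he hl hr hff hfe hee
  have hψ : ψ.comp (Units.coeHom _) = φ :=
    units_hom_ext hS fun v u => extend_of_unit hS _ e he hl hr hff hfe hee v u
  exact ⟨ψ, DFunLike.congr_fun hψ, fun v a ha => extend_of_nonunit hS _ _ _ _ _ _ _ _ ha⟩

theorem _root_.Subgroup.mem_of_smul_coe_eq {H : Type*} [Group H] {K : Subgroup H} {x : H}
    (h : x • (K : Set H) = K) : x ∈ K := by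
  have : x • (1 : H) ∈ x • (K : Set H) := Set.smul_mem_smul_set (one_mem K)
  rw [h] at this
  simpa using this

theorem _root_.Function.End.mul_apply {α : Type*} (f g : Function.End α) (x : α) :
    (f * g) x = f (g x) := rfl

theorem _root_.MulAction.toEndHom_apply_apply {H α : Type*} [Monoid H] [MulAction H α] (h : H)
    (x : α) : (MulAction.toEndHom h : Function.End α) x = h • x := rfl

/-- A vertex together with its neighbours. -/
def star (G : SimpleGraph V) (w : V) : Set V := {v | v = w ∨ G.Adj w v}

theorem units_smul_coe {U : Set V} {v : V} (hv : v ∈ U) (u : (S v)ˣ) :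
    Units.map (of G S v) u • (unitsOver G S U : Set (GraphProduct G S)ˣ) = unitsOver G S U :=
  smul_coe_set (map_of_mem_unitsOver hv u)

theorem self_mem_star (w : V) : w ∈ star G w := Or.inl rfl

theorem mem_star_of_adj {v w : V} (h : G.Adj w v) : v ∈ star G w := Or.inr h

/-- If a unit `x` fixes the class of a nonunit over `w`, then it lies over the star of `w`. -/
theorem mem_unitsOver_star_of_mul_nonunit (hS : ∀ v, IsRightLCM (S v)) {w : V} {a : S w}
    (ha : ¬ IsUnit a) {x y : (GraphProduct G S)ˣ} (h : x * of G S w a = of G S w a * y) :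
    x ∈ unitsOver G S (star G w) := by
  classical
  let B : Set (GraphProduct G S)ˣ := unitsOver G S (star G w)
  have hB : B ≠ ∅ := Set.Nonempty.ne_empty ⟨1, one_mem (unitsOver G S (star G w))⟩
  -- The empty set is an absorbing state. A constant map for `w` would not commute with the
  -- idempotents of its neighbours; fixing `∅` makes all of them commute.
  let e : V → Function.End (Set (GraphProduct G S)ˣ) := fun v T =>
    if v = w ∧ T ≠ ∅ then B else ∅
  obtain ⟨ψ, hψ, hψ'⟩ := exists_extension hS
    (MulAction.toEndHom : (GraphProduct G S)ˣ →* Function.End (Set (GraphProduct G S)ˣ)) e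
    (fun v => by
      funext T
      rw [Function.End.mul_apply]
      by_cases h : v = w ∧ T ≠ ∅ <;> simp_all [e])
    (fun v u => by
      funext T
      rw [Function.End.mul_apply, MulAction.toEndHom_apply_apply]
      by_cases h : v = w ∧ T ≠ ∅
      · simp only [e, if_pos h]
        exact units_smul_coe (h.1 ▸ self_mem_star v) u
      · simp only [e, if_neg h]
        exact Set.smul_set_empty)
    (fun v u => by
      funext T
      rw [Function.End.mul_apply, MulAction.toEndHom_apply_apply]
      simp [e])
    (fun v v' hv u => by
      funext T
      rw [Function.End.mul_apply, Function.End.mul_apply, MulAction.toEndHom_apply_apply,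
        MulAction.toEndHom_apply_apply]
      by_cases h : v' = w ∧ T ≠ ∅
      · have : Units.map (of G S v) u • B = B := units_smul_coe (h.1 ▸ mem_star_of_adj hv.symm) u
        simp_all [e]
      · have h' : ¬ (v' = w ∧ Units.map (of G S v) u • T ≠ ∅) := by simpa using h
        simp only [e, if_neg h, if_neg h']
        exact Set.smul_set_empty)
    (fun v v' hv => by
      funext T
      have := hv.ne
      rw [Function.End.mul_apply, Function.End.mul_apply]
      by_cases h : v = w <;> by_cases h' : v' = w <;> simp_all [e])
  -- The left side gives `x • B`. The right side gives `B`, because `y • B` is nonempty.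
  have := congrFun (congrArg ψ h) B
  rw [map_mul, map_mul, hψ, hψ, hψ' w a ha, Function.End.mul_apply, Function.End.mul_apply,
    MulAction.toEndHom_apply_apply, MulAction.toEndHom_apply_apply] at this
  refine Subgroup.mem_of_smul_coe_eq ?_
  simpa [e, hB] using this

/-- If a unit `x` fixes the class of an element with first letter a nonunit over `w`, then it
lies over the connected component of `w`. -/
theorem mem_unitsOver_supp_of_mul_nonunit_mul (hS : ∀ v, IsRightLCM (S v)) {w : V} {a : S w}
    (ha : ¬ IsUnit a) {t : GraphProduct G S} {x y : (GraphProduct G S)ˣ}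
    (h : x * (of G S w a * t) = of G S w a * t * y) :
    x ∈ unitsOver G S (G.connectedComponentMk w).supp := by
  -- Adjacent vertices have the same `B`, so here constant maps do commute, and nothing after the
  -- first nonunit letter matters.
  let B : V → Set (GraphProduct G S)ˣ := fun v => unitsOver G S (G.connectedComponentMk v).supp
  have hB : ∀ v w, G.Adj v w → B v = B w := fun v w h => by
    simp only [B, SimpleGraph.ConnectedComponent.connectedComponentMk_eq_of_adj h]
  obtain ⟨ψ, hψ, hψ'⟩ := exists_extension hS
    (MulAction.toEndHom : (GraphProduct G S)ˣ →* Function.End (Set (GraphProduct G S)ˣ))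
    (fun v _ => B v) (fun v => rfl)
    (fun v u => funext fun T => units_smul_coe (U := (G.connectedComponentMk v).supp) rfl u)
    (fun v u => rfl)
    (fun v v' hv u => funext fun T => by
      change Units.map (of G S v) u • B v' = B v'
      rw [← hB v v' hv]
      exact units_smul_coe (U := (G.connectedComponentMk v).supp) rfl u)
    (fun v v' hv => funext fun T => hB v v' hv)
  have := congrFun (congrArg ψ h) ∅
  rw [map_mul, map_mul, map_mul, map_mul, hψ, hψ, hψ' w a ha] at this
  exact Subgroup.mem_of_smul_coe_eq this

/-- The transformation that multiplies the first component by `g`, and the second component by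
the component of `g` at `u` if the first component is the subgroup over the star of `u`. -/
noncomputable def starAct (u : V) (g : (GraphProduct G S)ˣ) :
    Function.End (Set (GraphProduct G S)ˣ × S u) := fun p =>
  open Classical in
  (g • p.1, if p.1 = unitsOver G S (star G u) then toPi G S g u * p.2 else p.2)

theorem starAct_one (u : V) : starAct (G := G) (S := S) u 1 = 1 := by
  funext p
  simp only [starAct, one_smul, Units.val_one, map_one, Pi.one_apply, one_mul, ite_self]
  rfl

/-- In general `starAct` is not multiplicative: `h` may change whether the first component is the
star subgroup, and hence whether `g` acts on the second. Either alternative removes this dependence.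
-/
theorem starAct_mul (u : V) {g h : (GraphProduct G S)ˣ}
    (hgh : toPi G S g u = 1 ∨ h ∈ unitsOver G S (star G u)) :
    starAct u (g * h) = starAct u g * starAct u h := by
  classical
  funext p
  refine Prod.ext (mul_smul _ _ _) ?_
  simp only [starAct, Function.End.mul_def, Function.comp, Units.val_mul, map_mul, Pi.mul_apply]
  rcases hgh with hg | hh
  · simp [hg]
  · have : h • p.1 = unitsOver G S (star G u) ↔ p.1 = unitsOver G S (star G u) := by
      rw [← smul_coe_set hh, smul_left_cancel_iff, smul_coe_set hh]
    simp only [this]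
    split_ifs
    · rw [mul_assoc]
    · rfl

theorem toPi_map_of_ne {u v : V} (h : v ≠ u) (c : (S v)ˣ) :
    toPi G S (Units.map (of G S v) c : (GraphProduct G S)ˣ) u = 1 :=
  toPi_of_ne G S h.symm _

/-- Letters over one vertex, or over adjacent vertices in either order, satisfy the condition of
`starAct_mul`. As the unit group is the graph product of the vertex unit groups, the action extends
from letters. -/
theorem exists_starHom (hS : ∀ v, IsRightLCM (S v)) (u : V) :
    ∃ ψ : (GraphProduct G S)ˣ →* Function.End (Set (GraphProduct G S)ˣ × S u),
      ∀ v (c : (S v)ˣ), ψ (Units.map (of G S v) c) = starAct u (Units.map (of G S v) c) := by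
  let f : ∀ v, (S v)ˣ →* Function.End (Set (GraphProduct G S)ˣ × S u) := fun v =>
    { toFun := fun c => starAct u (Units.map (of G S v) c)
      map_one' := by rw [map_one, starAct_one]
      map_mul' := fun c d => by
        rw [map_mul]
        refine starAct_mul u ?_
        by_cases h : v = u
        · exact Or.inr (map_of_mem_unitsOver (h ▸ self_mem_star v) d)
        · exact Or.inl (toPi_map_of_ne h c) }
  have hf : ∀ v w, G.Adj v w → ∀ (c : (S v)ˣ) (d : (S w)ˣ),
      toPi G S (Units.map (of G S v) c : (GraphProduct G S)ˣ) u = 1 ∨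
        Units.map (of G S w) d ∈ unitsOver G S (star G u) := by
    intro v w h c d
    by_cases hv : v = u
    · exact Or.inr (map_of_mem_unitsOver (hv ▸ mem_star_of_adj h) d)
    · exact Or.inl (toPi_map_of_ne hv c)
  let ψ := lift G (fun v => (S v)ˣ) f (fun v w h c d => by
    change starAct u (Units.map (of G S v) c) * starAct u (Units.map (of G S w) d) =
      starAct u (Units.map (of G S w) d) * starAct u (Units.map (of G S v) c)
    rw [← starAct_mul u (hf v w h c d), ← starAct_mul u (hf w v h.symm d c)]
    exact congrArg _ (Units.ext (of_comm G S h _ _)))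
  refine ⟨ψ.comp (MulEquiv.ofBijective _ (unitsHom_bijective hS)).symm.toMonoidHom,
    fun v c => ?_⟩
  have : (MulEquiv.ofBijective _ (unitsHom_bijective hS)).symm (Units.map (of G S v) c) =
      of G (fun v => (S v)ˣ) v c := by
    rw [MulEquiv.symm_apply_eq]
    exact (unitsHom_of v c).symm
  simp only [MonoidHom.comp_apply, MulEquiv.toMonoidHom_eq_coe, MonoidHom.coe_coe, this]
  exact lift_of ..

/-- This replaces `mem_unitsOver_star_of_mul_nonunit` when `S u` is a group. Both sides act on the
pair (star subgroup, 1). If `x` moves the star subgroup, then `c` applied after `x` leaves the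
second component at 1, while `c` applied before `y` turns it into `c`. -/
theorem mem_unitsOver_star_of_conj (hS : ∀ v, IsRightLCM (S v)) {u : V} {c : (S u)ˣ}
    (hc : c ≠ 1) {x y : (GraphProduct G S)ˣ} (hx : x ∈ unitsOver G S {u}ᶜ)
    (hy : y ∈ unitsOver G S {u}ᶜ)
    (h : Units.map (of G S u) c * x = y * Units.map (of G S u) c) :
    x ∈ unitsOver G S (star G u) := by
  classical
  obtain ⟨ψ, hψ⟩ := exists_starHom (G := G) hS u
  have key : ∀ z ∈ unitsOver G S {u}ᶜ, toPi G S z u = 1 ∧ ψ z = starAct u z := by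
    intro z hz
    induction hz using Subgroup.closure_induction with
    | mem z hz =>
      obtain ⟨v, hv, d, rfl⟩ := hz
      exact ⟨toPi_map_of_ne hv d, hψ v d⟩
    | one => exact ⟨by simp, by rw [map_one, starAct_one]⟩
    | mul z z' _ _ h h' =>
      exact ⟨by simp [h.1, h'.1], by rw [map_mul, h.2, h'.2, starAct_mul u (Or.inl h.1)]⟩
    | inv z _ h =>
      refine ⟨?_, ?_⟩
      · have : toPi G S (↑z⁻¹ * ↑z : GraphProduct G S) u = 1 := by simp
        rwa [map_mul, Pi.mul_apply, h.1, mul_one] at this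
      · have h1 : starAct u z * starAct u z⁻¹ = 1 := by
          rw [← starAct_mul u (Or.inl h.1), mul_inv_cancel, starAct_one]
        rw [← mul_one (ψ z⁻¹), ← h1, ← mul_assoc, ← h.2, ← map_mul, inv_mul_cancel, map_one,
          one_mul]
  by_contra hn
  have hn' : x • (unitsOver G S (star G u) : Set (GraphProduct G S)ˣ) ≠ unitsOver G S (star G u) :=
    fun h => hn (Subgroup.mem_of_smul_coe_eq h)
  have := congrFun (congrArg ψ h) (unitsOver G S (star G u), 1)
  rw [map_mul, map_mul, (key x hx).2, (key y hy).2, hψ] at this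
  have h2 := congrArg Prod.snd this
  simp only [starAct, Function.End.mul_def, Function.comp, (key x hx).1, (key y hy).1, if_true,
    if_neg hn', one_mul, mul_one, ite_self, Units.coe_map,
    toPi_of_same] at h2
  exact hc (Units.ext h2.symm)

end Actions

end GraphProduct

/-! ### Monoids whose core is the group of units -/

section UnitCore

variable {M : Type*} [Monoid M]

theorem coreRel_iff_of_core_eq (hM : core M = IsUnit.submonoid M) {s t : M} :
    CoreRel s t ↔ ∃ u : Mˣ, s = t * u := by
  simp only [CoreRel, hM]
  constructor
  · rintro ⟨_, ⟨a, rfl⟩, _, ⟨b, rfl⟩, h⟩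
    refine ⟨b * a⁻¹, ?_⟩
    rw [Units.val_mul, ← mul_assoc, ← h, Units.mul_inv_cancel_right]
  · rintro ⟨u, rfl⟩
    exact ⟨1, one_mem _, u, u.isUnit, mul_one _⟩

theorem coreQuotient_mk_eq_iff (hM : core M = IsUnit.submonoid M) {s t : M} :
    (Quot.mk _ s : CoreQuotient M) = Quot.mk _ t ↔ ∃ u : Mˣ, s = t * u := by
  have : Equivalence (CoreRel (S := M)) := by
    simp only [funext₂ fun s t => propext (coreRel_iff_of_core_eq hM (s := s) (t := t))]
    refine ⟨fun s => ⟨1, by simp⟩, ?_, ?_⟩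
    · rintro s t ⟨u, rfl⟩
      exact ⟨u⁻¹, by simp⟩
    · rintro s t r ⟨u, rfl⟩ ⟨v, rfl⟩
      exact ⟨v * u, by simp [mul_assoc]⟩
  rw [← coreRel_iff_of_core_eq hM]
  exact this.quot_mk_eq_iff s t

theorem coreQuotient_mem_fixedBy_iff (hM : core M = IsUnit.submonoid M) {x : Mˣ} {s : M} :
    (Quot.mk _ s : CoreQuotient M) ∈ MulAction.fixedBy (CoreQuotient M) x ↔
      ∃ y : Mˣ, x * s = s * y :=
  coreQuotient_mk_eq_iff hM

theorem unitQuotient_mem_fixedBy_iff {x : Mˣ} {s : M} :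
    (Quotient.mk (Associated.setoid M) s : UnitQuotient M) ∈
      MulAction.fixedBy (UnitQuotient M) x ↔ ∃ y : Mˣ, x * s = s * y := by
  have : (Quotient.mk (Associated.setoid M) s : UnitQuotient M) ∈
      MulAction.fixedBy (UnitQuotient M) x ↔ Associated (x * s) s := Quotient.eq
  rw [this]
  exact ⟨fun h => h.symm.imp fun _ h => h.symm, fun ⟨y, h⟩ => Associated.symm ⟨y, h.symm⟩⟩

theorem coreIrreducibles_eq_of_core_eq (hM : core M = IsUnit.submonoid M) :
    coreIrreducibles M = {s | ¬ IsUnit s} := by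
  ext s
  simp only [coreIrreducibles, hM, Set.mem_ofPred_eq]
  exact ⟨fun h => h.1, fun h => ⟨h, fun _ _ ha _ => ha⟩⟩

theorem isCoreFactorable_of_core_eq (hM : core M = IsUnit.submonoid M) : IsCoreFactorable M := by
  intro s
  rw [coreIrreducibles_eq_of_core_eq hM, hM]
  by_cases hs : IsUnit s
  · exact ⟨1, Or.inr rfl, s, hs, (one_mul s).symm⟩
  · exact ⟨s, Or.inl hs, 1, one_mem _, (mul_one s).symm⟩

theorem isCapClosed_of_core_eq (hM : core M = IsUnit.submonoid M)
    (h : ∀ s t : M, IsUnit (s * t) → IsUnit s) : IsCapClosed (coreIrreducibles M) := by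
  rw [coreIrreducibles_eq_of_core_eq hM]
  intro s hs t _ r hr hu
  have : r ∈ rightIdeal s ∩ rightIdeal t := hr ▸ ⟨1, mul_one r⟩
  obtain ⟨⟨x, rfl⟩, -⟩ := this
  exact hs (h s x hu)

/-- If the action on `M/M*` is almost free, then no nontrivial unit is absorbed by an element. -/
theorem IsRightLCM.eq_one_of_mul_eq (hM : IsRightLCM M)
    (h : IsAlmostFree Mˣ (UnitQuotient M)) {u : Mˣ} {a : M} (hu : u * a = a) : u = 1 := by
  by_contra hne
  by_cases ha : IsUnit a
  · obtain ⟨b, rfl⟩ := ha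
    exact hne (Units.ext (b.mul_left_inj.1 (hu.trans (one_mul _).symm)))
  · refine (Set.infinite_of_injective_forall_mem
      (f := fun n : ℕ => (Quotient.mk (Associated.setoid M) (a ^ (n + 1)) : UnitQuotient M))
      (fun m n hmn => ?_) fun n => ?_) (h u hne)
    · exact Nat.succ_injective (hM.pow_not_associated ha (Quotient.exact hmn))
    · refine unitQuotient_mem_fixedBy_iff.2 ⟨1, ?_⟩
      rw [pow_succ', ← mul_assoc, hu, Units.val_one, mul_one]

end UnitCore

/-! ### Right multiplication in a free product -/

namespace Monoid.CoprodI

variable {ι : Type*} {M : ι → Type*} [∀ i, Monoid (M i)]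

theorem exists_eq_of_mul_prod (i : ι) (z : CoprodI M) :
    ∃ (h : M i) (t : Word M), t.fstIdx ≠ some i ∧ z = of h * t.prod := by
  classical
  let p := Word.equivPair i (Word.equiv z)
  refine ⟨p.head, p.tail, p.fstIdx_ne, ?_⟩
  rw [← Word.prod_rcons, ← Word.equivPair_symm, Equiv.symm_apply_apply]
  exact (Word.equiv.symm_apply_apply z).symm

theorem eq_of_of_mul_prod_eq {i : ι} {h h' : M i} {t t' : Word M} (ht : t.fstIdx ≠ some i)
    (ht' : t'.fstIdx ≠ some i) (he : of h * t.prod = of h' * t'.prod) : h = h' := by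
  classical
  have := Word.equiv.symm.injective (a₁ := Word.rcons ⟨h, t, ht⟩)
    (a₂ := Word.rcons ⟨h', t', ht'⟩) (by
      change Word.prod _ = Word.prod _
      simpa using he)
  exact congrArg Word.Pair.head (Word.rcons_inj this)

/-- Right multiplication does not change the index of the first letter of a nonunit. -/
theorem exists_word_mul (hM : ∀ i (a b : M i), a * b = 1 → b * a = 1) (y : CoprodI M)
    (W : Word M) (hW : ¬ IsUnit W.prod) :
    ∃ W' : Word M, W'.prod = W.prod * y ∧ W'.fstIdx = W.fstIdx := by
  induction W using Word.consRecOn with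
  | empty => exact absurd isUnit_one hW
  | cons i m w h1 h2 ih =>
    obtain ⟨h, t, ht, hz⟩ := exists_eq_of_mul_prod i (w.prod * y)
    -- If `m` cancelled, either the tail is a unit and so is the whole word, or by induction the
    -- tail times `y` still starts outside `i`, so that `h = 1` and `m = 1`.
    have hmh : m * h ≠ 1 := by
      intro hmh
      by_cases hw : IsUnit w.prod
      · refine hW ?_
        rw [Word.prod_cons]
        exact (IsUnit.map of ⟨⟨m, h, hmh, hM i m h hmh⟩, rfl⟩).mul hw
      · obtain ⟨w', hw', hf⟩ := ih hw
        have : 1 = h := eq_of_of_mul_prod_eq (hf ▸ h1) ht (by rw [map_one, one_mul, hw', hz])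
        exact h2 (by rwa [← this, mul_one] at hmh)
    refine ⟨Word.cons (m * h) t ht hmh, ?_, ?_⟩
    · rw [Word.prod_cons, Word.prod_cons, map_mul, mul_assoc, ← hz, mul_assoc]
    · rw [Word.fstIdx_cons, Word.fstIdx_cons]

/-- Heads at `i` are compared: the left side has head `u * a`. If the tail `t` is not a unit, right
multiplication by `y` does not alter its first index, so the right side has head `a`. -/
theorem exists_head_of_mul_eq_mul (hM : ∀ i (a b : M i), a * b = 1 → b * a = 1) {i : ι}
    {u : M i} {z y : CoprodI M} (h : of u * z = z * y) :
    ∃ (a : M i) (t : CoprodI M), z = of a * t ∧ (IsUnit t ∨ u * a = a) := by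
  obtain ⟨a, t, ht, rfl⟩ := exists_eq_of_mul_prod i z
  refine ⟨a, t.prod, rfl, ?_⟩
  by_cases hu : IsUnit t.prod
  · exact Or.inl hu
  · obtain ⟨t', ht', hf⟩ := exists_word_mul hM y t hu
    refine Or.inr (eq_of_of_mul_prod_eq ht (hf ▸ ht : t'.fstIdx ≠ some i) ?_)
    rw [ht', map_mul, mul_assoc, h, mul_assoc]

end Monoid.CoprodI

namespace GraphProduct

variable {V : Type*} {G : SimpleGraph V} {S : V → Type*} [∀ v, Monoid (S v)]

/-! ### Faithfulness -/

theorem map_of_ne_one {v : V} {u : (S v)ˣ} (hu : u ≠ 1) : Units.map (of G S v) u ≠ 1 := by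
  intro h
  refine hu (Units.ext ?_)
  have := congrArg (fun x : (GraphProduct G S)ˣ => toPi G S x v) h
  simpa using this

/-- If there are nonunits, then only the trivial unit fixes all classes `[s]`. -/
theorem eq_one_of_forall_mul_eq [Nontrivial V] (hG : IsCoconnected G) [∀ v, Nontrivial (S v)]
    (hS : ∀ v, IsRightLCM (S v)) {w : V} {a : S w} (ha : ¬ IsUnit a) {x : (GraphProduct G S)ˣ}
    (hx : ∀ s : GraphProduct G S, ∃ y : (GraphProduct G S)ˣ, x * s = s * y) : x = 1 := by
  let K : Set (GraphProduct G S)ˣ :=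
    {x | ∀ s : GraphProduct G S, ∃ y : (GraphProduct G S)ˣ, x * s = s * y}
  have hconj : ∀ x ∈ K, ∀ c : (GraphProduct G S)ˣ, c * x * c⁻¹ ∈ K := by
    intro x hx c s
    obtain ⟨y, hy⟩ := hx (↑c⁻¹ * s)
    refine ⟨y, ?_⟩
    rw [Units.val_mul, Units.val_mul, mul_assoc, mul_assoc, hy, mul_assoc, Units.mul_inv_cancel_left]
  have hstar : ∀ (u : V) (b : S u), ¬ IsUnit b → ∀ x ∈ K, x ∈ unitsOver G S (star G u) := by
    intro u b hb x hx
    obtain ⟨y, hy⟩ := hx (of G S u b)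
    exact mem_unitsOver_star_of_mul_nonunit hS hb hy
  have hsub : ∀ u v : V, v ≠ u → ¬ G.Adj u v → star G u ⊆ {v}ᶜ := by
    rintro u v hvu hadj z (rfl | hz) rfl
    · exact hvu rfl
    · exact hadj hz
  -- The vertices that cannot be avoided in writing `K`. Every vertex of `T` will be adjacent to
  -- every vertex outside it.
  let T : Set V := {u | ∃ x ∈ K, x ∉ unitsOver G S {u}ᶜ}
  have hadj : ∀ v ∈ T, ∀ u ∈ Tᶜ, G.Adj v u := by
    rintro v ⟨x, hx, hxv⟩ u hu
    by_contra hvu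
    have hne : v ≠ u := by
      rintro rfl
      exact hu ⟨x, hx, hxv⟩
    refine hxv (unitsOver_mono (hsub u v hne fun h => hvu h.symm) ?_)
    by_cases hb : ∀ b : S u, IsUnit b
    · obtain ⟨b, hb1⟩ := exists_ne (1 : S u)
      obtain ⟨c, rfl⟩ := hb b
      have hK : ∀ z ∈ K, z ∈ unitsOver G S {u}ᶜ := by
        intro z hz
        by_contra hzu
        exact hu ⟨z, hz, hzu⟩
      -- Since `K` is closed under conjugation, both `x` and its conjugate by `c` avoid `u`.
      exact mem_unitsOver_star_of_conj hS (fun h => hb1 (congrArg Units.val h)) (hK x hx)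
        (hK _ (hconj x hx (Units.map (of G S u) c))) (by group)
    · obtain ⟨b, hb⟩ := not_forall.1 hb
      exact hstar u b hb x hx
  obtain ⟨v, hv, hwv⟩ := hG.exists_not_adj w
  have hvT : v ∈ Tᶜ := fun ⟨x, hx, hxv⟩ => hxv (unitsOver_mono (hsub w v hv hwv) (hstar w a ha x hx))
  have hT : ∀ u, u ∉ T := fun u hu =>
    hG ⟨T, Tᶜ, ⟨u, hu⟩, ⟨v, hvT⟩, disjoint_compl_right, Set.union_compl_self _, hadj⟩
  refine eq_one_of_forall_mem_unitsOver_compl fun u => ?_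
  by_contra hu
  exact hT u ⟨x, hx, hu⟩

theorem faithfulSMul_iff [Nontrivial V] (hG : IsCoconnected G) [∀ v, Nontrivial (S v)]
    (hS : ∀ v, IsRightLCM (S v)) :
    FaithfulSMul (GraphProduct G S)ˣ (CoreQuotient (GraphProduct G S)) ↔
      ¬ ∀ s : GraphProduct G S, IsUnit s := by
  have hc := core_eq hG hS
  constructor
  · intro hf hall
    obtain ⟨v⟩ := (inferInstance : Nonempty V)
    obtain ⟨m, hm⟩ := exists_ne (1 : S v)
    obtain ⟨u, rfl⟩ := isUnit_of_iff.1 (hall (of G S v m))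
    refine map_of_ne_one (G := G) (fun h => hm (congrArg Units.val h)) (hf.eq_of_smul_eq_smul ?_)
    rintro ⟨s⟩
    refine (coreQuotient_mk_eq_iff hc).2 ?_
    obtain ⟨s, rfl⟩ := hall s
    exact ⟨s⁻¹ * Units.map (of G S v) u * s, by simp [← mul_assoc]⟩
  · intro h
    obtain ⟨s, hs⟩ := not_forall.1 h
    obtain ⟨b, w, a, t, ha, rfl⟩ := exists_eq_of_not_isUnit hs
    refine ⟨fun {x y} hxy => ?_⟩
    refine (inv_mul_eq_one.1 (eq_one_of_forall_mul_eq hG hS ha (x := y⁻¹ * x) fun s => ?_)).symm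
    refine (coreQuotient_mem_fixedBy_iff hc).1 ?_
    exact (mul_smul _ _ _).trans ((congrArg _ (hxy _)).trans (inv_smul_smul _ _))

/-! ### Almost freeness -/

/-- The canonical map from `S v/(S v)*` to `S/∼`. -/
def ofQuotient (G : SimpleGraph V) (S : V → Type*) [∀ v, Monoid (S v)] (v : V) :
    UnitQuotient (S v) → CoreQuotient (GraphProduct G S) :=
  Quotient.lift (fun s => Quot.mk _ (of G S v s)) (by
    rintro s t ⟨u, rfl⟩
    refine Quot.sound ⟨of G S v u, fun s => not_orthogonal_iff.2 ?_, 1, one_mem _, by simp⟩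
    exact ⟨of G S v ↑u⁻¹ * s, 1, by rw [← mul_assoc, ← map_mul]; simp⟩)

theorem associated_of_of_eq_mul {v : V} {s t : S v} {u : (GraphProduct G S)ˣ}
    (h : of G S v s = of G S v t * u) : Associated s t := by
  refine Associated.symm ⟨Units.map ((Pi.evalMonoidHom S v).comp (toPi G S)) u, ?_⟩
  have := congrArg (fun x => toPi G S x v) h
  simpa using this.symm

theorem ofQuotient_injective (hc : core (GraphProduct G S) = IsUnit.submonoid _) (v : V) :
    Function.Injective (ofQuotient G S v) := by
  rintro ⟨s⟩ ⟨t⟩ h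
  obtain ⟨u, hu⟩ := (coreQuotient_mk_eq_iff hc).1 h
  exact Quotient.sound (associated_of_of_eq_mul hu)

theorem isAlmostFree_vertex (hc : core (GraphProduct G S) = IsUnit.submonoid _)
    (h : IsAlmostFree (GraphProduct G S)ˣ (CoreQuotient (GraphProduct G S))) (v : V) :
    IsAlmostFree (S v)ˣ (UnitQuotient (S v)) := by
  intro g hg
  refine ((h _ (map_of_ne_one (G := G) hg)).preimage
    (ofQuotient_injective hc v).injOn).subset ?_
  rintro ⟨s⟩ hs
  obtain ⟨y, hy⟩ := unitQuotient_mem_fixedBy_iff.1 hs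
  refine (coreQuotient_mem_fixedBy_iff hc).2 ⟨Units.map (of G S v) y, ?_⟩
  rw [Units.coe_map, Units.coe_map]
  exact (map_mul (of G S v) _ _).symm.trans ((congrArg _ hy).trans (map_mul _ _ _))

theorem not_isAlmostFree_of_adj (hS : ∀ v, IsRightLCM (S v))
    (hc : core (GraphProduct G S) = IsUnit.submonoid _) {p q : V} (hpq : G.Adj p q)
    {c : (S p)ˣ} (hcne : c ≠ 1) {a : S q} (ha : ¬ IsUnit a) :
    ¬ IsAlmostFree (GraphProduct G S)ˣ (CoreQuotient (GraphProduct G S)) := by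
  intro h
  refine (Set.infinite_of_injective_forall_mem
    (f := fun n : ℕ => (Quot.mk _ (of G S q (a ^ n)) : CoreQuotient (GraphProduct G S)))
    (fun m n hmn => ?_) fun n => ?_) (h _ (map_of_ne_one (G := G) hcne))
  · obtain ⟨u, hu⟩ := (coreQuotient_mk_eq_iff hc).1 hmn
    exact (hS q).pow_not_associated ha (associated_of_of_eq_mul hu)
  · exact (coreQuotient_mem_fixedBy_iff hc).2 ⟨Units.map (of G S p) c, of_comm G S hpq _ _⟩

theorem forall_isUnit_or_forall_eq_one [∀ v, Nontrivial (S v)] (hS : ∀ v, IsRightLCM (S v))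
    (hc : core (GraphProduct G S) = IsUnit.submonoid _)
    (h : IsAlmostFree (GraphProduct G S)ˣ (CoreQuotient (GraphProduct G S)))
    (U : G.ConnectedComponent) (hU : U.supp.Nontrivial) :
    (∀ u ∈ U.supp, ∀ s : S u, IsUnit s) ∨ (∀ u ∈ U.supp, ∀ s : S u, IsUnit s → s = 1) := by
  by_contra! hn
  obtain ⟨⟨q, hq, a, ha⟩, p, hp, c, hc', hc1⟩ := hn
  have key : ∀ v w, G.Adj v w → (∃ c : (S v)ˣ, c ≠ 1) → ∀ b : S w, IsUnit b := by
    rintro v w hvw ⟨c, hcne⟩ b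
    by_contra hb
    exact not_isAlmostFree_of_adj hS hc hvw hcne hb h
  have step : ∀ v w, G.Adj v w → (∃ c : (S v)ˣ, c ≠ 1) → ∃ c : (S w)ˣ, c ≠ 1 := by
    intro v w hvw hv
    obtain ⟨b, hb⟩ := exists_ne (1 : S w)
    obtain ⟨b, rfl⟩ := key v w hvw hv b
    exact ⟨b, fun h => hb (congrArg Units.val h)⟩
  have walk : ∀ v w, G.Walk v w → (∃ c : (S v)ˣ, c ≠ 1) → ∃ c : (S w)ˣ, c ≠ 1 := by
    intro v w W
    induction W with
    | nil => exact id
    | cons hadj _ ih => exact fun h => ih (step _ _ hadj h)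
  obtain ⟨W⟩ := SimpleGraph.ConnectedComponent.exact (hp.trans hq.symm)
  have hq' := walk p q W ⟨hc'.unit, fun h => hc1 (congrArg Units.val h)⟩
  -- A neighbour of `q` is needed: the nontrivial unit passes from `q` to it and, seen from there,
  -- forces every element of `S q` to be a unit.
  obtain ⟨z, hz, hzq⟩ := hU.exists_ne q
  obtain ⟨W⟩ := SimpleGraph.ConnectedComponent.exact (hq.trans hz.symm)
  cases W with
  | nil => exact hzq rfl
  | cons hadj _ => exact ha (key _ q hadj.symm (step q _ hadj hq') a)

/-- Over an isolated vertex, a fixed point of a unit comes from the vertex monoid, or the unit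
is absorbed by an element of the vertex monoid. -/
theorem exists_of_isolated (hS : ∀ v, IsRightLCM (S v)) {w : V} (hw : ∀ v, ¬ G.Adj w v) {u : S w}
    {s y : GraphProduct G S} (h : of G S w u * s = s * y) :
    ∃ a : S w, (∃ x : (GraphProduct G S)ˣ, s = of G S w a * x) ∨ u * a = a := by
  classical
  -- Letters over `w` go to one copy and all others to the second; this respects the relations
  -- because `w` is isolated. Using the whole graph product twice avoids the graph product over the
  -- complement of `w`.
  let P := Monoid.CoprodI fun _ : Bool => GraphProduct G S
  let ψ : GraphProduct G S →* P := lift G S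
    (fun v => (Monoid.CoprodI.of (i := decide (v = w))).comp (of G S v)) (by
      intro v v' hv s t
      have h1 : v ≠ w := by
        rintro rfl
        exact hw _ hv
      have h2 : v' ≠ w := by
        rintro rfl
        exact hw _ hv.symm
      simp only [h1, h2, decide_false, MonoidHom.comp_apply, ← map_mul, of_comm G S hv])
  let π : GraphProduct G S →* S w := (Pi.evalMonoidHom S w).comp (toPi G S)
  -- A left inverse of `ψ`. It retracts the first copy to `S w`, so that any head there yields an
  -- element of the vertex monoid.
  let φ : P →* GraphProduct G S := Monoid.CoprodI.lift fun b =>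
    match b with
    | true => (of G S w).comp π
    | false => MonoidHom.id _
  have hφw : ∀ z, φ (Monoid.CoprodI.of (i := true) z) = of G S w (π z) :=
    fun z => Monoid.CoprodI.lift_of _ _
  have hφ : ∀ z, φ (Monoid.CoprodI.of (i := false) z) = z := fun z => Monoid.CoprodI.lift_of _ _
  have hφψ : ∀ s, φ (ψ s) = s := by
    intro s
    refine DFunLike.congr_fun (f := φ.comp ψ) (g := MonoidHom.id _) (hom_ext fun v s => ?_) s
    by_cases hv : v = w
    · subst hv
      simp [ψ, hφw, π]
    · simp [ψ, hφ, hv]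
  have hψu : ψ (of G S w u) = Monoid.CoprodI.of (i := true) (of G S w u) := by
    simp [ψ]
  have hP := congrArg ψ h
  rw [map_mul, map_mul, hψu] at hP
  obtain ⟨a, t, hz, ht⟩ := Monoid.CoprodI.exists_head_of_mul_eq_mul
    (fun _ _ _ => mul_eq_one_symm hS) hP
  refine ⟨π a, ht.imp (fun ht => ?_) fun ht => ?_⟩
  · refine ⟨(ht.map φ).unit, ?_⟩
    rw [← hφψ s, hz, map_mul, hφw]
    rfl
  · simpa [π] using congrArg π ht

theorem fixedBy_finite_of_isolated (hS : ∀ v, IsRightLCM (S v))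
    (hc : core (GraphProduct G S) = IsUnit.submonoid _) {w : V} (hw : ∀ v, ¬ G.Adj w v)
    (h : IsAlmostFree (S w)ˣ (UnitQuotient (S w))) {u : (S w)ˣ} (hu : u ≠ 1) :
    (MulAction.fixedBy (CoreQuotient (GraphProduct G S)) (Units.map (of G S w) u)).Finite := by
  refine ((h u hu).image (ofQuotient G S w)).subset ?_
  rintro ⟨s⟩ hs
  obtain ⟨y, hy⟩ := (coreQuotient_mem_fixedBy_iff hc).1 hs
  obtain ⟨a, ⟨x, rfl⟩ | ha⟩ := exists_of_isolated hS hw hy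
  · refine ⟨Quotient.mk _ a, unitQuotient_mem_fixedBy_iff.2 ?_,
      (coreQuotient_mk_eq_iff hc).2 ⟨x⁻¹, by simp⟩⟩
    have : of G S w (u * a) = of G S w a * ↑(x * y * x⁻¹) := by
      rw [map_mul, Units.val_mul, Units.val_mul, ← mul_assoc, ← mul_assoc, ← hy]
      simp [mul_assoc]
    exact (associated_of_of_eq_mul this).symm.imp fun _ h => h.symm
  · exact absurd ((hS w).eq_one_of_mul_eq h ha) hu

/-- If `x` fixes the class of a nonunit `b * (a * t)`, then `b⁻¹ * x * b` lies over the component of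
`w`, which the second hypothesis shrinks to `{w}`. Translation by `b` carries the fixed points of
the conjugate to those of `x`. Otherwise the class of 1 is the only possible fixed point. -/
theorem isAlmostFree_of_vertices (hS : ∀ v, IsRightLCM (S v))
    (hc : core (GraphProduct G S) = IsUnit.submonoid _)
    (h1 : ∀ v : V, (∀ w : V, ¬ G.Adj v w) → IsAlmostFree (S v)ˣ (UnitQuotient (S v)))
    (h2 : ∀ U : G.ConnectedComponent, U.supp.Nontrivial →
      (∀ u ∈ U.supp, ∀ s : S u, IsUnit s) ∨ (∀ u ∈ U.supp, ∀ s : S u, IsUnit s → s = 1)) :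
    IsAlmostFree (GraphProduct G S)ˣ (CoreQuotient (GraphProduct G S)) := by
  intro x hx
  by_cases hs : ∃ s : GraphProduct G S, ¬ IsUnit s ∧ ∃ y : (GraphProduct G S)ˣ, x * s = s * y
  · obtain ⟨s, hs, y, hy⟩ := hs
    obtain ⟨b, w, a, t, ha, rfl⟩ := exists_eq_of_not_isUnit hs
    have hmem : b⁻¹ * x * b ∈ unitsOver G S (G.connectedComponentMk w).supp := by
      refine mem_unitsOver_supp_of_mul_nonunit_mul hS ha (t := t) (y := y) ?_
      rw [Units.val_mul, Units.val_mul, mul_assoc, mul_assoc, hy, mul_assoc,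
        Units.inv_mul_cancel_left]
    have hne : b⁻¹ * x * b ≠ 1 := fun h => hx (by
      rw [mul_assoc, inv_mul_eq_one] at h
      simpa using h)
    have hsupp : (G.connectedComponentMk w).supp ⊆ {w} := by
      by_contra hnt
      have hnt' : (G.connectedComponentMk w).supp.Nontrivial := by
        obtain ⟨z, hz, hzw⟩ := Set.not_subset.1 hnt
        exact ⟨w, rfl, z, hz, fun h => hzw h.symm⟩
      rcases h2 _ hnt' with hu | hu
      · exact ha (hu w rfl a)
      · refine hne ((Subgroup.closure_le (K := (⊥ : Subgroup (GraphProduct G S)ˣ))).2 ?_ hmem)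
        rintro _ ⟨v, hv, c, rfl⟩
        have : c = 1 := Units.ext (hu v hv c c.isUnit)
        rw [this, map_one]
        exact one_mem _
    have hw : ∀ v, ¬ G.Adj w v := by
      intro v hv
      have : v ∈ (G.connectedComponentMk w).supp :=
        (SimpleGraph.ConnectedComponent.connectedComponentMk_eq_of_adj hv).symm
      exact hv.ne (hsupp this).symm
    obtain ⟨u, hu⟩ : b⁻¹ * x * b ∈ (Units.map (of G S w)).range := by
      refine (Subgroup.closure_le _).2 ?_ hmem
      rintro _ ⟨v, hv, c, rfl⟩
      obtain rfl : v = w := hsupp hv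
      exact ⟨c, rfl⟩
    have hu1 : u ≠ 1 := by
      rintro rfl
      exact hne (by rw [← hu, map_one])
    refine ((fixedBy_finite_of_isolated hS hc hw (h1 w hw) hu1).image (b • ·)).subset ?_
    intro q hq
    refine ⟨b⁻¹ • q, ?_, smul_inv_smul b q⟩
    rw [hu, MulAction.mem_fixedBy, mul_smul, mul_smul, smul_inv_smul, hq]
  · refine (Set.finite_singleton (Quot.mk _ 1)).subset ?_
    rintro ⟨s⟩ hq
    have hu : IsUnit s := by
      by_contra hu
      exact hs ⟨s, hu, (coreQuotient_mem_fixedBy_iff hc).1 hq⟩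
    obtain ⟨u, rfl⟩ := hu
    exact (coreQuotient_mk_eq_iff hc).2 ⟨u, (one_mul _).symm⟩

end GraphProduct

theorem mainTheorem4 {V : Type*} [Nontrivial V] (G : SimpleGraph V) (hG : IsCoconnected G)
    (S : V → Type*) [∀ v, Monoid (S v)] [∀ v, Nontrivial (S v)]
    (hS : ∀ v, IsRightLCM (S v)) :
    -- units, core, core irreducible elements
    (Function.Bijective (GraphProduct.unitsHom G S) ∧
      core (GraphProduct G S) = IsUnit.submonoid (GraphProduct G S) ∧
      coreIrreducibles (GraphProduct G S) = {s | ¬ IsUnit s}) ∧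
    -- the core relation
    (∀ s t : GraphProduct G S, CoreRel s t ↔ ∃ u : (GraphProduct G S)ˣ, s = t * u) ∧
    -- factorability
    (IsCoreFactorable (GraphProduct G S) ∧ IsCapClosed (coreIrreducibles (GraphProduct G S))) ∧
    -- faithfulness
    (FaithfulSMul (GraphProduct G S)ˣ (CoreQuotient (GraphProduct G S)) ↔
      ¬ ∀ s : GraphProduct G S, IsUnit s) ∧
    -- almost freeness
    (IsAlmostFree (GraphProduct G S)ˣ (CoreQuotient (GraphProduct G S)) ↔
      (∀ v : V, (∀ w : V, ¬ G.Adj v w) → IsAlmostFree (S v)ˣ (UnitQuotient (S v))) ∧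
      (∀ U : G.ConnectedComponent, U.supp.Nontrivial →
        (∀ u ∈ U.supp, ∀ s : S u, IsUnit s) ∨ (∀ u ∈ U.supp, ∀ s : S u, IsUnit s → s = 1))) := by
  have hc := GraphProduct.core_eq hG hS
  exact ⟨⟨GraphProduct.unitsHom_bijective hS, hc, coreIrreducibles_eq_of_core_eq hc⟩,
    fun s t => coreRel_iff_of_core_eq hc,
    ⟨isCoreFactorable_of_core_eq hc,
      isCapClosed_of_core_eq hc fun s t h => (GraphProduct.isUnit_mul hS h).1⟩,
    GraphProduct.faithfulSMul_iff hG hS,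
    fun h => ⟨fun v _ => GraphProduct.isAlmostFree_vertex hc h v,
      GraphProduct.forall_isUnit_or_forall_eq_one hS hc h⟩,
    fun h => GraphProduct.isAlmostFree_of_vertices hS hc h.1 h.2⟩
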